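/- Let $d$ be a natural number and let $\mathcal P(\mathbb R^d)$ be the set of Borel probability measures on $\mathbb R^d$. For every integer $k\ge 1$ let $(P^k_z)_{z\in\mathbb R^d}$ be a Feller system in $\mathcal P(\mathbb R^d)$, i.e. $z\mapsto\int f\,dP^k_z$ is continuous on $\mathbb R^d$ for every $f\in C_b(\mathbb R^d)$ (bounded continuous real functions). Suppose that for each $z\in\mathbb R^d$ the sequence $(P^k_z)_{k\ge1}$ obeys the large deviation principle in $\mathbb R^d$ with speed $k$ and good rate function $c_z:\mathbb R^d\to[0,\infty]$; that is, $c_z$ is lower semicontinuous, its level sets $\{c_z\le a\}$, $0\le a<\infty$, are compact, and for every Borel set $A\subset\mathbb R^d$ $$-\inf_{\operatorname{int}A}c_z\le\liminf_{k\to\infty}\tfrac1k\log P^k_z(A)\le\limsup_{k\to\infty}\tfrac1k\log P^k_z(A)\le-\inf_{\operatorname{cl}A}c_z .$$ Put $c(x_0,x_1)=c_{x_0}(x_1)$ and, for $f\in C_b(\mathbb R^d)$ and $z\in\mathbb R^d$, $\mathcal S_1f(z)=\inf_{x_1\in\mathbb R^d}\{c(z,x_1)+f(x_1)\}$. For $\mu,\nu\in\mathcal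 P(\mathbb R^d)$ put $$\mathcal T_c(\mu,\nu)=\inf_{\rho}\int_{\mathbb R^d\times\mathbb R^d}c\,d\rho\in[0,\infty],$$ the infimum being over all Borel probability measures $\rho$ on $\mathbb R^d\times\mathbb R^d$ with marginals $\mu$ and $\nu$. Let $\mu\in\mathcal P(\mathbb R^d)$. Then $c$ is Borel measurable on $\mathbb R^d\times\mathbb R^d$, for every $f\in C_b(\mathbb R^d)$ the function $\mathcal S_1f$ is real-valued and $\mu$-integrable, and for all $\nu\in\mathcal P(\mathbb R^d)$ $$\mathcal T_c(\mu,\nu)=\sup_{f\in C_b(\mathbb R^d)}\left\{\int_{\mathbb R^d}\mathcal S_1f(x_0)\,\mu(dx_0)-\int_{\mathbb R^d}f(x_1)\,\nu(dx_1)\right\}$$ as an identity in $[0,\infty]$. -/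

import Mathlib

open MeasureTheory Filter Topology Set
open scoped ENNReal NNReal BoundedContinuousFunction

/-- A system of Borel probability measures `(P z)` on `X` indexed by `Z` is a Feller system if
`z ↦ ∫ f dP_z` is continuous for every bounded continuous `f`. -/
def IsFellerSystem {Z X : Type*} [TopologicalSpace Z] [TopologicalSpace X] [MeasurableSpace X]
    (P : Z → ProbabilityMeasure X) : Prop :=
  ∀ f : X →ᵇ ℝ, Continuous fun z => ∫ x, f x ∂(P z : Measure X)

/-- The sequence of laws `(ρ n)` obeys the large deviation principle with speed `n` and rate
function `I : V → [0,∞]`. Here `ENNReal.log 0 = -∞`, and an infimum over the empty set is `+∞`. -/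
def ObeysLDP {V : Type*} [TopologicalSpace V] [MeasurableSpace V]
    (ρ : ℕ → ProbabilityMeasure V) (I : V → ℝ≥0∞) : Prop :=
  LowerSemicontinuous I ∧
    ∀ A : Set V, MeasurableSet A →
      -(⨅ v ∈ interior A, (I v : EReal)) ≤
          liminf (fun n : ℕ => ENNReal.log ((ρ n : Measure V) A) / (n : EReal)) atTop ∧
        limsup (fun n : ℕ => ENNReal.log ((ρ n : Measure V) A) / (n : EReal)) atTop ≤
          -(⨅ v ∈ closure A, (I v : EReal))

/-- A rate function is good if all its level sets `{I ≤ a}`, with `a` finite, are compact. -/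
def IsGoodRate {V : Type*} [TopologicalSpace V] (I : V → ℝ≥0∞) : Prop :=
  ∀ a : ℝ≥0, IsCompact {v : V | I v ≤ a}

/-- The set `Π(μ, ν)` of all probability measures on `X × X` with marginals `μ` and `ν`. -/
def transportPlans {X : Type*} [MeasurableSpace X] (μ ν : ProbabilityMeasure X) :
    Set (ProbabilityMeasure (X × X)) :=
  {ρ | (ρ : Measure (X × X)).map Prod.fst = (μ : Measure X) ∧
    (ρ : Measure (X × X)).map Prod.snd = (ν : Measure X)}

/-- The optimal transport cost `𝒯_c(μ, ν) = inf { ∫ c dρ : ρ ∈ Π(μ, ν) } ∈ [0,∞]`. -/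
noncomputable def transportCost {X : Type*} [MeasurableSpace X] (c : X → X → ℝ≥0∞)
    (μ ν : ProbabilityMeasure X) : ℝ≥0∞ :=
  ⨅ ρ ∈ transportPlans μ ν, ∫⁻ p, c p.1 p.2 ∂(ρ : Measure (X × X))

/-- `𝒮₁ f (z) = inf_x { c(z, x) + f(x) }`, as an extended real number. -/
noncomputable def infTransform {X : Type*} [TopologicalSpace X] (c : X → X → ℝ≥0∞)
    (f : X →ᵇ ℝ) (z : X) : EReal :=
  ⨅ x : X, ((c z x : EReal) + ((f x : ℝ) : EReal))

/-! The cost is lower semicontinuous in its second variable but has no evident topological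
regularity in the first; the proof replaces that regularity by measurability and then by a change of
topology.

For a closed ball `B`, the Feller property makes `z ↦ P k z B` Borel, hence so is the exponential
rate `-liminf (1/k) log P k z B`. The large deviation bounds squeeze this rate between the infima of
`c z` over the closed and the open ball (`exists_isBallInfimum`). Over a countable base of balls
these rates recover `c` as a supremum of products of a continuous function of `x` and a measurable
function of `z` (`eq_iSup`), and the transform as a countable infimum (`infTransform_eq`). All
measurability claims follow.

For such costs, a finer Polish topology on the first factor, with the same Borel sets, makes the
measurable factors continuous, so that `c` is an increasing limit of bounded continuous costs. For
these, Hahn–Banach separation and a measurable selection of near-minimizers give plans with first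
marginal `μ`, second marginal close to `ν` and cost close to the dual value
(`exists_plan_of_mem_nhds`). Tightness and monotone convergence yield an exact coupling. -/

/-! ### Separation by bounded continuous functions -/

/-- The evaluation pairing between linear functionals on `Y →ᵇ ℝ` and `Y →ᵇ ℝ`. -/
noncomputable abbrev evalPairing (Y : Type*) [TopologicalSpace Y] :
    ((Y →ᵇ ℝ) →ₗ[ℝ] ℝ) →ₗ[ℝ] (Y →ᵇ ℝ) →ₗ[ℝ] ℝ :=
  LinearMap.id

/-- Linear functionals on `Y →ᵇ ℝ` with the topology of pointwise convergence. -/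
abbrev PointwiseDual (Y : Type*) [TopologicalSpace Y] : Type _ := WeakBilin (evalPairing Y)

/-- The functional `f ↦ ∫ f dν`. -/
noncomputable def integralFunctional {Y : Type*} [TopologicalSpace Y] [MeasurableSpace Y]
    [OpensMeasurableSpace Y] (ν : Measure Y) [IsFiniteMeasure ν] : PointwiseDual Y :=
  ({ toFun := fun f => ∫ y, f y ∂ν
     map_add' := fun f g => integral_add (f.integrable ν) (g.integrable ν)
     map_smul' := fun a f => integral_const_mul a f } : (Y →ᵇ ℝ) →ₗ[ℝ] ℝ)

/-- Weak convergence of laws is convergence of all integrals of bounded continuous functions. This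
turns closeness of functionals, which is what separation yields, into closeness of second marginals.
-/
theorem comap_integralFunctional_nhds_le {Y : Type*} [TopologicalSpace Y] [MeasurableSpace Y]
    [OpensMeasurableSpace Y] (ν : ProbabilityMeasure Y) :
    comap (fun ν' : ProbabilityMeasure Y => integralFunctional (ν' : Measure Y))
      (𝓝 (integralFunctional (ν : Measure Y))) ≤ 𝓝 ν := by
  rw [← tendsto_id', ProbabilityMeasure.tendsto_iff_forall_integral_tendsto]
  intro f
  exact ((WeakBilin.eval_continuous (evalPairing Y) f).tendsto _).comp tendsto_comap

/-- A point of `ℝ × PointwiseDual Y` off a closed convex set is strictly separated from it by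
a pair `(a, f)` consisting of a number and a bounded continuous function. -/
theorem exists_separating_boundedContinuousFunction {Y : Type*} [TopologicalSpace Y]
    {s : Set (ℝ × PointwiseDual Y)} (hs : Convex ℝ s) (hs' : IsClosed s)
    {p : ℝ × PointwiseDual Y} (hp : p ∉ s) :
    ∃ (a : ℝ) (f : Y →ᵇ ℝ) (u : ℝ),
      a * p.1 + evalPairing Y p.2 f < u ∧
      ∀ q ∈ s, u < a * q.1 + evalPairing Y q.2 f := by
  obtain ⟨L, u, hL, hu⟩ := geometric_hahn_banach_point_closed hs hs' hp
  -- In the topology of pointwise convergence every continuous linear functional is evaluation at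
  -- some `f`.
  obtain ⟨f, hf⟩ := LinearMap.dualEmbedding_surjective _
    (L.comp (ContinuousLinearMap.inr ℝ ℝ (PointwiseDual Y)))
  have key : ∀ q : ℝ × PointwiseDual Y,
      L q = L (1, 0) * q.1 + evalPairing Y q.2 f := by
    intro q
    have h1 : q = q.1 • ((1 : ℝ), (0 : PointwiseDual Y)) + (0, q.2) := by
      ext1 <;> simp
    have h2 : L (0, q.2) = evalPairing Y q.2 f :=
      (DFunLike.congr_fun hf q.2).symm
    conv_lhs => rw [h1, map_add, map_smul, h2]
    rw [smul_eq_mul, mul_comm]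
  refine ⟨L (1, 0), f, u, ?_, fun q hq => ?_⟩
  · rw [← key]; exact hL
  · rw [← key]; exact hu q hq

/-! ### Duality for bounded continuous costs -/

/-- Near-minimizers of a function which is measurable in the first and continuous in the second
variable can be selected measurably. -/
theorem exists_measurable_selection {X Y : Type*} [MeasurableSpace X] [TopologicalSpace Y]
    [TopologicalSpace.SeparableSpace Y] [Nonempty Y] [MeasurableSpace Y] {h : X → Y → ℝ} {C : ℝ}
    (hm : ∀ y, Measurable fun x => h x y) (hc : ∀ x, Continuous (h x))
    (hC : ∀ x y, |h x y| ≤ C) {ε : ℝ} (hε : 0 < ε) :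
    ∃ (g : X → ℝ) (s : X → Y), Measurable g ∧ Measurable s ∧ (∀ x, |g x| ≤ C) ∧
      (∀ x y, g x ≤ h x y) ∧ ∀ x, h x (s x) ≤ g x + ε := by
  have hbdd : ∀ x, BddBelow (range fun k => h x (TopologicalSpace.denseSeq Y k)) := fun x =>
    ⟨-C, by rintro _ ⟨k, rfl⟩; exact (abs_le.1 (hC x _)).1⟩
  let g : X → ℝ := fun x => ⨅ k, h x (TopologicalSpace.denseSeq Y k)
  have hgm : Measurable g := Measurable.iInf fun k => hm _
  have hex : ∀ x, ∃ k, h x (TopologicalSpace.denseSeq Y k) < g x + ε := fun x =>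
    exists_lt_of_ciInf_lt (lt_add_of_pos_right _ hε)
  classical
  -- The first index that works depends measurably on `x`, being determined by countably many
  -- measurable conditions.
  refine ⟨g, fun x => TopologicalSpace.denseSeq Y (Nat.find (hex x)), hgm, ?_, ?_, ?_, ?_⟩
  · exact (measurable_from_nat (f := TopologicalSpace.denseSeq Y)).comp
      (measurable_find hex fun k => measurableSet_lt (hm _) (hgm.add_const ε))
  · intro x
    refine abs_le.2 ⟨le_ciInf fun k => (abs_le.1 (hC x _)).1, ?_⟩
    exact (ciInf_le (hbdd x) 0).trans (abs_le.1 (hC x _)).2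
  · intro x y
    have hcl : IsClosed {y | g x ≤ h x y} := isClosed_le continuous_const (hc x)
    have : range (TopologicalSpace.denseSeq Y) ⊆ {y | g x ≤ h x y} := by
      rintro _ ⟨k, rfl⟩
      exact ciInf_le (hbdd x) k
    exact hcl.closure_subset_iff.2 this
      ((TopologicalSpace.denseRange_denseSeq Y) y)
  · exact fun x => (Nat.find_spec (hex x)).le

/-- The points `(t, Λ)` such that some law `ρ` on `X × Y` with first marginal `μ` has `∫ c dρ ≤ t`
and `Λ` as integration functional of its second marginal. -/
def costEpigraph {X Y : Type*} [MeasurableSpace X] [TopologicalSpace Y] [MeasurableSpace Y]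
    (c : X × Y → ℝ) (μ : Measure X) : Set (ℝ × PointwiseDual Y) :=
  {p | ∃ ρ : ProbabilityMeasure (X × Y), (ρ : Measure (X × Y)).map Prod.fst = μ ∧
    ∫ q, c q ∂(ρ : Measure (X × Y)) ≤ p.1 ∧
    ∀ f : Y →ᵇ ℝ, evalPairing Y p.2 f = ∫ q, f q.2 ∂(ρ : Measure (X × Y))}

section Polish

variable {X Y : Type*} [TopologicalSpace X] [MeasurableSpace X] [BorelSpace X]
  [TopologicalSpace Y] [PolishSpace Y] [MeasurableSpace Y] [BorelSpace Y]

theorem convex_costEpigraph (c : X × Y →ᵇ ℝ) (μ : ProbabilityMeasure X) :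
    Convex ℝ (costEpigraph c (μ : Measure X)) := by
  rintro p ⟨ρ, h1, h2, h3⟩ q ⟨σ, k1, k2, k3⟩ a b ha hb hab
  have hint : ∀ f : X × Y →ᵇ ℝ,
      ∫ z, f z ∂(ENNReal.ofReal a • (ρ : Measure (X × Y)) + ENNReal.ofReal b • (σ : Measure (X × Y)))
        = a * ∫ z, f z ∂(ρ : Measure (X × Y)) + b * ∫ z, f z ∂(σ : Measure (X × Y)) := by
    intro f
    rw [integral_add_measure ((f.integrable _).smul_measure ENNReal.ofReal_ne_top)
      ((f.integrable _).smul_measure ENNReal.ofReal_ne_top), integral_smul_measure,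
      integral_smul_measure, ENNReal.toReal_ofReal ha, ENNReal.toReal_ofReal hb, smul_eq_mul,
      smul_eq_mul]
  have hsum : ENNReal.ofReal a + ENNReal.ofReal b = 1 := by
    rw [← ENNReal.ofReal_add ha hb, hab, ENNReal.ofReal_one]
  refine ⟨⟨ENNReal.ofReal a • (ρ : Measure (X × Y)) + ENNReal.ofReal b • (σ : Measure (X × Y)),
    ⟨?_⟩⟩, ?_, ?_, ?_⟩
  · simp [hsum]
  · rw [ProbabilityMeasure.coe_mk, Measure.map_add _ _ measurable_fst, Measure.map_smul,
      Measure.map_smul, h1, k1, ← add_smul, hsum, one_smul]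
  · rw [ProbabilityMeasure.coe_mk, hint]
    simp only [Prod.fst_add, Prod.smul_fst, smul_eq_mul]
    gcongr
  · intro f
    have := hint (f.compContinuous ⟨Prod.snd, continuous_snd⟩)
    simp only [BoundedContinuousFunction.compContinuous_apply, ContinuousMap.coe_mk] at this
    rw [ProbabilityMeasure.coe_mk, this, ← h3, ← k3]
    rfl

/-- The integral of the infimum over the second variable is approached by laws with prescribed
first marginal. -/
theorem exists_plan_integral_le (h : X × Y →ᵇ ℝ) (μ : ProbabilityMeasure X) [Nonempty Y]
    {ε : ℝ} (hε : 0 < ε) :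
    ∃ (g : X → ℝ) (ρ : ProbabilityMeasure (X × Y)), Measurable g ∧ (∃ C, ∀ x, |g x| ≤ C) ∧
      (∀ x y, g x ≤ h (x, y)) ∧ (ρ : Measure (X × Y)).map Prod.fst = μ ∧
      ∫ q, h q ∂(ρ : Measure (X × Y)) ≤ ∫ x, g x ∂(μ : Measure X) + ε := by
  obtain ⟨g, s, hg, hs, hgC, hgh, hsg⟩ := exists_measurable_selection (h := fun x y => h (x, y))
    (C := ‖h‖) (fun y => (h.continuous.comp (Continuous.prodMk_left y)).measurable)
    (fun x => h.continuous.comp (Continuous.prodMk_right x)) (fun x y => h.norm_coe_le_norm _) hε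
  have hm : Measurable fun x => (x, s x) := measurable_id.prodMk hs
  have hgi : Integrable g (μ : Measure X) :=
    Integrable.of_bound hg.aestronglyMeasurable ‖h‖ (Eventually.of_forall hgC)
  refine ⟨g, μ.map hm.aemeasurable, hg, ⟨_, hgC⟩, hgh, ?_, ?_⟩
  · rw [ProbabilityMeasure.toMeasure_map, Measure.map_map measurable_fst hm]
    exact Measure.map_id
  · rw [ProbabilityMeasure.toMeasure_map,
      integral_map hm.aemeasurable h.continuous.measurable.aestronglyMeasurable]
    calc ∫ x, h (x, s x) ∂(μ : Measure X) ≤ ∫ x, (g x + ε) ∂(μ : Measure X) := by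
          refine integral_mono ?_ (hgi.add (integrable_const ε)) hsg
          exact Integrable.of_bound (h.continuous.measurable.comp hm).aestronglyMeasurable ‖h‖
            (Eventually.of_forall fun x => h.norm_coe_le_norm _)
      _ = _ := by rw [integral_add hgi (integrable_const ε)]; simp

/-- If the dual value is at most `D`, there are laws with first marginal `μ`, second marginal close
to `ν` and cost close to `D`. -/
theorem exists_plan_of_mem_nhds (c : X × Y →ᵇ ℝ) (hc : ∀ p, 0 ≤ c p) (μ : ProbabilityMeasure X)
    (ν : ProbabilityMeasure Y) {D : ℝ}
    (hD : ∀ (f : Y →ᵇ ℝ) (g : X → ℝ), Measurable g → (∃ C, ∀ x, |g x| ≤ C) →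
      (∀ x y, g x ≤ c (x, y) + f y) →
      ∫ x, g x ∂(μ : Measure X) - ∫ y, f y ∂(ν : Measure Y) ≤ D)
    {U : Set (ProbabilityMeasure Y)} (hU : U ∈ 𝓝 ν) {ε : ℝ} (hε : 0 < ε) :
    ∃ ρ : ProbabilityMeasure (X × Y), (ρ : Measure (X × Y)).map Prod.fst = μ ∧
      ρ.map measurable_snd.aemeasurable ∈ U ∧ ∫ q, c q ∂(ρ : Measure (X × Y)) ≤ D + ε := by
  have : Nonempty Y := ν.nonempty
  have hmem : (D, integralFunctional (ν : Measure Y)) ∈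
      closure (costEpigraph c (μ : Measure X)) := by
    by_contra hnot
    have hconv : Convex ℝ (closure (costEpigraph c (μ : Measure X))) :=
      Convex.closure (𝕜 := ℝ) (E := ℝ × PointwiseDual Y) (convex_costEpigraph c μ)
    obtain ⟨a, f, u, hlt, hgt⟩ := exists_separating_boundedContinuousFunction
      hconv isClosed_closure hnot
    change a * D + ∫ y, f y ∂(ν : Measure Y) < u at hlt
    have hplan : ∀ ρ : ProbabilityMeasure (X × Y), (ρ : Measure (X × Y)).map Prod.fst = μ →
        ∀ t, ∫ q, c q ∂(ρ : Measure (X × Y)) ≤ t →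
        u < a * t + ∫ q, f q.2 ∂(ρ : Measure (X × Y)) := by
      intro ρ hρ t ht
      have := hgt (t, integralFunctional ((ρ : Measure (X × Y)).map Prod.snd))
        (subset_closure ⟨ρ, hρ, ht, fun f => integral_map measurable_snd.aemeasurable
          f.continuous.measurable.aestronglyMeasurable⟩)
      refine this.trans_eq ?_
      congr 1
      exact integral_map measurable_snd.aemeasurable
          f.continuous.measurable.aestronglyMeasurable
    -- The set contains every larger `t` along with each of its points, so `a < 0` would violate the
    -- lower bound `u` once `t ≥ (u - J) / a`.
    have ha : 0 ≤ a := by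
      by_contra! ha
      obtain ⟨-, ρ, -, -, -, hρ, -⟩ := exists_plan_integral_le c μ one_pos
      set J := ∫ q, f q.2 ∂(ρ : Measure (X × Y))
      have := hplan ρ hρ (max (∫ q, c q ∂(ρ : Measure (X × Y))) ((u - J) / a)) (le_max_left _ _)
      have h2 := mul_le_mul_of_nonpos_left (le_max_right (∫ q, c q ∂(ρ : Measure (X × Y)))
        ((u - J) / a)) ha.le
      rw [mul_div_cancel₀ _ ha.ne] at h2
      linarith
    -- The hyperplane may be vertical, `a = 0`. The strict inequality leaves room to raise `a`, and
    -- since `c ≥ 0` this only helps on the other side.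
    obtain ⟨η, hη, hηlt⟩ : ∃ η > 0, (a + η) * D + ∫ y, f y ∂(ν : Measure Y) < u := by
      have hcont : Tendsto (fun η : ℝ => (a + η) * D + ∫ y, f y ∂(ν : Measure Y)) (𝓝[>] 0)
          (𝓝 ((a + 0) * D + ∫ y, f y ∂(ν : Measure Y))) :=
        (Continuous.tendsto (by fun_prop) _).mono_left nhdsWithin_le_nhds
      rw [add_zero] at hcont
      obtain ⟨η, h1, h2⟩ := ((hcont.eventually_lt_const hlt).and self_mem_nhdsWithin).exists
      exact ⟨η, h2, h1⟩
    have hb : 0 < a + η := by linarith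
    set F : Y →ᵇ ℝ := (a + η)⁻¹ • f with hF
    have hFi : ∀ m : Measure Y, ∫ y, F y ∂m = (a + η)⁻¹ * ∫ y, f y ∂m := fun m =>
      integral_const_mul _ _
    -- With this choice `(a + η) * δ` is exactly the gap left below `u`.
    set δ := (u - ((a + η) * D + ∫ y, f y ∂(ν : Measure Y))) / (a + η)
    have hδ : 0 < δ := div_pos (by linarith) hb
    obtain ⟨g, ρ, hg, hgC, hgh, hρ, hρg⟩ := exists_plan_integral_le
      (c + F.compContinuous ⟨Prod.snd, continuous_snd⟩) μ hδ
    have h1 := hD F g hg hgC hgh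
    have h2 := hplan ρ hρ _ le_rfl
    have h3 : 0 ≤ ∫ q, c q ∂(ρ : Measure (X × Y)) := integral_nonneg hc
    have h4 : ∫ q, (c + F.compContinuous ⟨Prod.snd, continuous_snd⟩ : X × Y →ᵇ ℝ) q
        ∂(ρ : Measure (X × Y))
        = ∫ q, c q ∂(ρ : Measure (X × Y)) +
          (a + η)⁻¹ * ∫ q, f q.2 ∂(ρ : Measure (X × Y)) := by
      rw [← integral_const_mul]
      exact integral_add (c.integrable _)
        ((F.compContinuous ⟨Prod.snd, continuous_snd⟩).integrable _)
    rw [h4] at hρg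
    rw [hFi] at h1
    have h5 : (a + η) * δ = u - ((a + η) * D + ∫ y, f y ∂(ν : Measure Y)) :=
      mul_div_cancel₀ _ hb.ne'
    have h6 := mul_le_mul_of_nonneg_left hρg hb.le
    have h7 := mul_le_mul_of_nonneg_left h1 hb.le
    rw [mul_add, mul_add, mul_inv_cancel_left₀ hb.ne', h5] at h6
    rw [mul_sub, mul_inv_cancel_left₀ hb.ne'] at h7
    -- Now `(a + η) ∫ c + ∫ f ≤ u < a ∫ c + ∫ f` for the plan `ρ`, which forces `η ∫ c < 0`.
    nlinarith
  obtain ⟨V, hV, hVU⟩ := mem_comap.1 (comap_integralFunctional_nhds_le ν hU)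
  obtain ⟨⟨t, Λ⟩, ⟨ht, hΛ⟩, ρ, hρ, hρt, hρΛ⟩ := mem_closure_iff_nhds.1 hmem _
    (prod_mem_nhds (Iio_mem_nhds (lt_add_of_pos_right D hε)) hV)
  refine ⟨ρ, hρ, hVU ?_, hρt.trans (le_of_lt ht)⟩
  have : integralFunctional ((ρ.map measurable_snd.aemeasurable : ProbabilityMeasure Y) :
      Measure Y) = Λ := by
    refine LinearMap.ext fun f => ?_
    exact (integral_map measurable_snd.aemeasurable
      f.continuous.measurable.aestronglyMeasurable).trans (hρΛ f).symm
  rw [mem_preimage, this]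
  exact hΛ

variable [PolishSpace X]

/-- If the dual values of an increasing sequence of bounded continuous costs are at most `D`, there
is a coupling whose costs are all at most `D`. -/
theorem exists_coupling_of_dual_le (c : ℕ → X × Y →ᵇ ℝ) (hc : ∀ n p, 0 ≤ c n p)
    (hmono : ∀ p, Monotone fun n => c n p) (μ : ProbabilityMeasure X)
    (ν : ProbabilityMeasure Y) {D : ℝ}
    (hD : ∀ (n : ℕ) (f : Y →ᵇ ℝ) (g : X → ℝ), Measurable g → (∃ C, ∀ x, |g x| ≤ C) →
      (∀ x y, g x ≤ c n (x, y) + f y) →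
      ∫ x, g x ∂(μ : Measure X) - ∫ y, f y ∂(ν : Measure Y) ≤ D) :
    ∃ ρ : ProbabilityMeasure (X × Y), (ρ : Measure (X × Y)).map Prod.fst = μ ∧
      (ρ : Measure (X × Y)).map Prod.snd = ν ∧ ∀ n, ∫ q, c n q ∂(ρ : Measure (X × Y)) ≤ D := by
  obtain ⟨U, hU⟩ := (𝓝 ν).exists_antitone_basis
  choose ρ hρ1 hρ2 hρc using fun n : ℕ => exists_plan_of_mem_nhds (c n) (hc n) μ ν (hD n)
    (hU.mem n) (Nat.one_div_pos_of_nat (α := ℝ) (n := n))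
  have hsnd : Tendsto (fun n => (ρ n).map measurable_snd.aemeasurable) atTop (𝓝 ν) :=
    hU.tendsto hρ2
  -- Tightness of both marginals suffices: the first is constantly `μ`, the second converges to `ν`.
  have htight : IsTightMeasureSet {((m : ProbabilityMeasure (X × Y)) : Measure (X × Y)) |
      m ∈ range ρ} := by
    apply IsTightMeasureSet.prodMk
    · refine (isTightMeasureSet_singleton (μ := (μ : Measure X))).subset ?_
      rintro _ ⟨_, ⟨_, ⟨n, rfl⟩, rfl⟩, rfl⟩
      exact hρ1 n
    · have hcomp : IsCompact (closure (insert ν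
          (range fun n => (ρ n).map measurable_snd.aemeasurable))) :=
        hsnd.isCompact_insert_range.closure
      let := TopologicalSpace.upgradeIsCompletelyMetrizable Y
      refine (isTightMeasureSet_of_isCompact_closure hcomp).subset ?_
      rintro _ ⟨_, ⟨_, ⟨n, rfl⟩, rfl⟩, rfl⟩
      exact ⟨_, mem_insert_of_mem _ ⟨n, rfl⟩, rfl⟩
  obtain ⟨σ, -, φ, hφ, hlim⟩ := (isCompact_closure_of_isTightMeasureSet htight).isSeqCompact
    (fun n => subset_closure (mem_range_self n))
  have hfst : σ.map measurable_fst.aemeasurable = μ := by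
    refine tendsto_nhds_unique (((ProbabilityMeasure.continuous_map continuous_fst).tendsto σ).comp
      hlim) (tendsto_const_nhds.congr fun n => Subtype.ext (hρ1 _).symm)
  have hsnd' : σ.map measurable_snd.aemeasurable = ν :=
    tendsto_nhds_unique (((ProbabilityMeasure.continuous_map continuous_snd).tendsto σ).comp hlim)
      (hsnd.comp hφ.tendsto_atTop)
  refine ⟨σ, congrArg Subtype.val hfst, congrArg Subtype.val hsnd', fun m => ?_⟩
  have h1 := (ProbabilityMeasure.tendsto_iff_forall_integral_tendsto.1 hlim) (c m)
  have h2 : Tendsto (fun k => D + 1 / ((φ k : ℝ) + 1)) atTop (𝓝 (D + 0)) :=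
    (tendsto_one_div_add_atTop_nhds_zero_nat.comp hφ.tendsto_atTop).const_add D
  rw [add_zero] at h2
  refine le_of_tendsto_of_tendsto h1 h2 ?_
  -- Once `φ k ≥ m`, the cost `c m` is dominated by `c (φ k)`, which the plan `ρ (φ k)` was chosen
  -- to control.
  filter_upwards [hφ.tendsto_atTop.eventually_ge_atTop m] with k hk
  exact (integral_mono ((c m).integrable _) ((c (φ k)).integrable _)
    fun p => hmono p hk).trans (hρc _)

end Polish

/-! ### Costs that are countable suprema of products -/

/-- Finite truncations of a supremum of products `φ i y * ℓ i x`. -/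
noncomputable def truncatedSup {X Y : Type*} (φ : ℕ → Y → ℝ≥0) (ℓ : ℕ → X → ℝ≥0∞) (n : ℕ)
    (p : X × Y) : ℝ≥0 :=
  (Finset.range n).sup fun i => φ i p.2 * (min (ℓ i p.1) n).toNNReal

section truncatedSup

variable {X Y : Type*} {φ : ℕ → Y → ℝ≥0} {ℓ : ℕ → X → ℝ≥0∞}

theorem coe_toNNReal_min_natCast (a : ℝ≥0∞) (n : ℕ) :
    ((min a n).toNNReal : ℝ≥0∞) = min a n :=
  ENNReal.coe_toNNReal (min_lt_of_right_lt (ENNReal.natCast_lt_top n)).ne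

theorem truncatedSup_mono (p : X × Y) : Monotone fun n => truncatedSup φ ℓ n p := by
  intro m n hmn
  refine (Finset.sup_mono (Finset.range_mono hmn)).trans (Finset.sup_mono_fun fun i _ => ?_)
  refine mul_le_mul' le_rfl ?_
  rw [← ENNReal.coe_le_coe, coe_toNNReal_min_natCast, coe_toNNReal_min_natCast]
  gcongr

theorem truncatedSup_le (hφ : ∀ i y, φ i y ≤ 1) (n : ℕ) (p : X × Y) :
    truncatedSup φ ℓ n p ≤ n := by
  refine Finset.sup_le fun i _ => ?_
  have h : (min (ℓ i p.1) n).toNNReal ≤ n := by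
    rw [← ENNReal.coe_le_coe, coe_toNNReal_min_natCast]
    exact min_le_right _ _
  exact (mul_le_of_le_one_left' (hφ i p.2)).trans h

theorem iSup_truncatedSup (p : X × Y) :
    ⨆ n, (truncatedSup φ ℓ n p : ℝ≥0∞) = ⨆ i, (φ i p.2 : ℝ≥0∞) * ℓ i p.1 := by
  refine le_antisymm (iSup_le fun n => ?_) (iSup_le fun i => ?_)
  · rw [truncatedSup, ENNReal.coe_finset_sup]
    refine Finset.sup_le fun i _ => le_iSup_of_le i ?_
    rw [ENNReal.coe_mul, coe_toNNReal_min_natCast]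
    gcongr
    exact min_le_left _ _
  · have : ℓ i p.1 = ⨆ n : ℕ, min (ℓ i p.1) n := by
      refine le_antisymm ?_ (iSup_le fun n => min_le_left _ _)
      rw [← inf_iSup_eq, ENNReal.iSup_natCast, inf_top_eq]
    rw [this, ENNReal.mul_iSup]
    -- The term `i` enters the finite supremum only from index `i + 1` on.
    refine iSup_le fun n => le_iSup_of_le (max n (i + 1)) ?_
    rw [truncatedSup, ENNReal.coe_finset_sup]
    refine le_trans ?_ (Finset.le_sup (b := i) (Finset.mem_range.2 (by omega)))
    rw [ENNReal.coe_mul, coe_toNNReal_min_natCast]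
    gcongr
    exact le_max_left _ _

theorem continuous_truncatedSup [TopologicalSpace X] [TopologicalSpace Y]
    (hφ : ∀ i, Continuous (φ i)) (hℓ : ∀ i, Continuous (ℓ i)) (n : ℕ) :
    Continuous (truncatedSup φ ℓ n) := by
  refine Continuous.finset_sup_apply fun i _ => ((hφ i).comp continuous_snd).mul ?_
  exact ENNReal.continuousOn_toNNReal.comp_continuous
    (((hℓ i).comp continuous_fst).min continuous_const)
    fun p => (min_lt_of_right_lt (ENNReal.natCast_lt_top n)).ne

end truncatedSup

/-- A Polish topology refining another one has the same Borel sets. -/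
theorem borelSpace_of_polishSpace_of_le {X : Type*} [m : MeasurableSpace X]
    {t t' : TopologicalSpace X} (ht : @PolishSpace X t) (ht' : @PolishSpace X t') (hle : t ≤ t')
    (h : @BorelSpace X t' m) : @BorelSpace X t m :=
  @BorelSpace.mk X t m (h.measurable_eq.trans (borel_eq_borel_of_le ht ht' hle).symm)

section Polish

variable {X Y : Type*} [TopologicalSpace X] [hX : PolishSpace X] [MeasurableSpace X]
  [hXB : BorelSpace X]
  [TopologicalSpace Y] [PolishSpace Y] [MeasurableSpace Y] [BorelSpace Y]

theorem exists_coupling_lintegral_le_of_continuous {c : X → Y → ℝ≥0∞} {φ : ℕ → Y → ℝ≥0}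
    (hφ : ∀ i, Continuous (φ i)) (hφ1 : ∀ i y, φ i y ≤ 1) {ℓ : ℕ → X → ℝ≥0∞}
    (hℓ : ∀ i, Continuous (ℓ i)) (hc : ∀ x y, c x y = ⨆ i, (φ i y : ℝ≥0∞) * ℓ i x)
    (μ : ProbabilityMeasure X) (ν : ProbabilityMeasure Y) {D : ℝ}
    (hD : ∀ (f : Y →ᵇ ℝ) (g : X → ℝ), Measurable g → (∃ C, ∀ x, |g x| ≤ C) →
      (∀ x y, (g x : EReal) ≤ (c x y : EReal) + ((f y : ℝ) : EReal)) →
      ∫ x, g x ∂(μ : Measure X) - ∫ y, f y ∂(ν : Measure Y) ≤ D) :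
    ∃ ρ : ProbabilityMeasure (X × Y), (ρ : Measure (X × Y)).map Prod.fst = μ ∧
      (ρ : Measure (X × Y)).map Prod.snd = ν ∧
      ∫⁻ q, c q.1 q.2 ∂(ρ : Measure (X × Y)) ≤ ENNReal.ofReal D := by
  have hcont := continuous_truncatedSup hφ hℓ
  let C : ℕ → X × Y →ᵇ ℝ := fun n => BoundedContinuousFunction.ofNormedAddCommGroup
    (fun p => (truncatedSup φ ℓ n p : ℝ)) (NNReal.continuous_coe.comp (hcont n)) n fun p => by
      rw [Real.norm_of_nonneg (NNReal.coe_nonneg _)]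
      exact_mod_cast truncatedSup_le hφ1 n p
  have hC : ∀ n p, C n p = truncatedSup φ ℓ n p := fun n p => rfl
  have hsup : ∀ p : X × Y, c p.1 p.2 = ⨆ n, (truncatedSup φ ℓ n p : ℝ≥0∞) := fun p => by
    rw [hc, iSup_truncatedSup]
  have hle : ∀ n x y, ((C n (x, y) : ℝ) : EReal) ≤ (c x y : EReal) := fun n x y => by
    have h4 : (truncatedSup φ ℓ n (x, y) : ℝ≥0∞) ≤ c x y := by
      rw [hsup (x, y)]
      exact le_iSup (fun n => (truncatedSup φ ℓ n (x, y) : ℝ≥0∞)) n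
    exact EReal.coe_ennreal_le_coe_ennreal_iff.2 h4
  obtain ⟨ρ, h1, h2, h3⟩ := exists_coupling_of_dual_le C (fun n p => NNReal.coe_nonneg _)
    (fun p m n hmn => NNReal.coe_le_coe.2 (truncatedSup_mono p hmn)) μ ν (D := D)
    (fun n f g hg hgC hgf => hD f g hg hgC fun x y =>
      (EReal.coe_le_coe_iff.2 (hgf x y)).trans (by
        rw [EReal.coe_add]
        exact add_le_add_left (hle n x y) _))
  refine ⟨ρ, h1, h2, ?_⟩
  simp_rw [hsup]
  rw [lintegral_iSup (fun n => (hcont n).measurable.coe_nnreal_ennreal)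
    fun m n hmn p => ENNReal.coe_le_coe.2 (truncatedSup_mono p hmn)]
  refine iSup_le fun n => ?_
  refine le_trans (le_of_eq ?_) (ENNReal.ofReal_le_ofReal (h3 n))
  rw [ofReal_integral_eq_lintegral_ofReal ((C n).integrable _)
    (Eventually.of_forall fun p => NNReal.coe_nonneg _)]
  exact lintegral_congr fun p => (ENNReal.ofReal_coe_nnreal).symm

/-- Kantorovich duality, hard direction, for a cost which is a countable supremum of products of a
measurable function of the first and a continuous function of the second variable: if the dual
values are at most `D`, there is a coupling of cost at most `D`. -/
theorem exists_coupling_lintegral_le {c : X → Y → ℝ≥0∞} {φ : ℕ → Y → ℝ≥0}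
    (hφ : ∀ i, Continuous (φ i)) (hφ1 : ∀ i y, φ i y ≤ 1) {ℓ : ℕ → X → ℝ≥0∞}
    (hℓ : ∀ i, Measurable (ℓ i)) (hc : ∀ x y, c x y = ⨆ i, (φ i y : ℝ≥0∞) * ℓ i x)
    (μ : ProbabilityMeasure X) (ν : ProbabilityMeasure Y) {D : ℝ}
    (hD : ∀ (f : Y →ᵇ ℝ) (g : X → ℝ), Measurable g → (∃ C, ∀ x, |g x| ≤ C) →
      (∀ x y, (g x : EReal) ≤ (c x y : EReal) + ((f y : ℝ) : EReal)) →
      ∫ x, g x ∂(μ : Measure X) - ∫ y, f y ∂(ν : Measure Y) ≤ D) :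
    ∃ ρ : ProbabilityMeasure (X × Y), (ρ : Measure (X × Y)).map Prod.fst = μ ∧
      (ρ : Measure (X × Y)).map Prod.snd = ν ∧
      ∫⁻ q, c q.1 q.2 ∂(ρ : Measure (X × Y)) ≤ ENNReal.ofReal D := by
  -- The finer topology `t` makes all `ℓ i` continuous without changing the Borel sets. The bound
  -- `hD` survives because it asks of `g` only measurability and boundedness.
  obtain ⟨t, ht, htℓ, htP⟩ := (measurable_pi_lambda (fun x i => ℓ i x) hℓ).exists_continuous
  have hB : @BorelSpace X t _ := borelSpace_of_polishSpace_of_le htP hX ht hXB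
  have hℓ' : ∀ i, @Continuous X _ t _ (ℓ i) := fun i =>
    @Continuous.comp X (ℕ → ℝ≥0∞) ℝ≥0∞ t _ _ (fun x i => ℓ i x) (fun p => p i) (continuous_apply i)
      htℓ
  exact @exists_coupling_lintegral_le_of_continuous X Y t htP _ hB _ _ _ _ c φ hφ hφ1 ℓ hℓ' hc μ ν
    D hD

end Polish

/-! ### Measurability from the large deviation principle -/

/-- The indicator of a closed set is a pointwise limit of bounded continuous functions, whose
integrals are continuous in `z`. -/
theorem IsFellerSystem.measurable_closed {Z X : Type*} [TopologicalSpace Z] [MeasurableSpace Z]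
    [OpensMeasurableSpace Z] [TopologicalSpace X] [HasOuterApproxClosed X] [MeasurableSpace X]
    [BorelSpace X] {P : Z → ProbabilityMeasure X} (hP : IsFellerSystem P) {F : Set X}
    (hF : IsClosed F) : Measurable fun z => (P z : Measure X) F := by
  refine measurable_of_tendsto_metrizable (f := fun n z => ∫⁻ x, hF.apprSeq n x ∂(P z : Measure X))
    (fun n => ?_) (tendsto_pi_nhds.2 fun z => HasOuterApproxClosed.tendsto_lintegral_apprSeq hF _)
  have h := ProbabilityMeasure.continuous_iff_forall_continuous_lintegral.1
    (ProbabilityMeasure.continuous_iff_forall_continuous_integral.2 hP) (hF.apprSeq n)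
  exact h.measurable

section Balls

variable {X : Type*} [PseudoMetricSpace X] [TopologicalSpace.SeparableSpace X] [Nonempty X]

/-- Centres of a countable base of balls, indexed by centre and inverse radius. -/
noncomputable def ballCenter (X : Type*) [PseudoMetricSpace X] [TopologicalSpace.SeparableSpace X]
    [Nonempty X] (i : ℕ × ℕ) : X :=
  TopologicalSpace.denseSeq X i.1

/-- Radii of a countable base of balls, indexed by centre and inverse radius. -/
noncomputable def ballRadius (i : ℕ × ℕ) : ℝ := 1 / ((i.2 : ℝ) + 1)

theorem exists_closedBall_subset {U : Set X} (hU : IsOpen U) {x : X} (hx : x ∈ U) :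
    ∃ i, x ∈ Metric.ball (ballCenter X i) (ballRadius i) ∧
      Metric.closedBall (ballCenter X i) (ballRadius i) ⊆ U := by
  obtain ⟨ε, hε, hεU⟩ := Metric.isOpen_iff.1 hU x hx
  obtain ⟨n, hn⟩ := exists_nat_one_div_lt (half_pos hε)
  obtain ⟨q, hq⟩ := (TopologicalSpace.denseRange_denseSeq X).exists_dist_lt x
    (Nat.one_div_pos_of_nat (α := ℝ) (n := n))
  refine ⟨(q, n), hq, fun y hy => hεU ?_⟩
  rw [Metric.mem_closedBall] at hy
  rw [Metric.mem_ball]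
  change dist y (TopologicalSpace.denseSeq X q) ≤ 1 / ((n : ℝ) + 1) at hy
  rw [dist_comm] at hq
  linarith [dist_triangle y (TopologicalSpace.denseSeq X q) x]

/-- A family of functions on `Z` squeezed between the infima of `c z` over the closed and open balls
of a countable base. -/
def IsBallInfimum {Z : Type*} (c : Z → X → ℝ≥0∞) (ℓ : ℕ × ℕ → Z → ℝ≥0∞) : Prop :=
  ∀ i z, (∀ a : ℝ≥0∞, (∀ x ∈ Metric.closedBall (ballCenter X i) (ballRadius i), a ≤ c z x) →
      a ≤ ℓ i z) ∧ ∀ x ∈ Metric.ball (ballCenter X i) (ballRadius i), ℓ i z ≤ c z x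

/-- The exponential decay rate of the closed ball works: the upper bound sees the closed ball, the
lower bound its interior, which contains the open ball. A countable liminf preserves measurability.
-/
theorem exists_isBallInfimum {Z : Type*} [TopologicalSpace Z] [MeasurableSpace Z]
    [OpensMeasurableSpace Z] [MeasurableSpace X] [BorelSpace X]
    {P : ℕ → Z → ProbabilityMeasure X} {c : Z → X → ℝ≥0∞}
    (hFeller : ∀ k : ℕ, 1 ≤ k → IsFellerSystem (P k))
    (hLDP : ∀ z, ObeysLDP (fun k => P k z) (c z)) :
    ∃ ℓ : ℕ × ℕ → Z → ℝ≥0∞, (∀ i, Measurable (ℓ i)) ∧ IsBallInfimum c ℓ := by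
  let B : ℕ × ℕ → Set X := fun i => Metric.closedBall (ballCenter X i) (ballRadius i)
  let L : ℕ × ℕ → Z → EReal := fun i z =>
    liminf (fun n : ℕ => ENNReal.log ((P n z : Measure X) (B i)) / (n : EReal)) atTop
  have hL : ∀ i, Measurable (L i) := by
    intro i
    -- The shift by one discards `k = 0`, where no Feller property is assumed.
    have : L i = fun z => liminf (fun n : ℕ =>
        ENNReal.log ((P (n + 1) z : Measure X) (B i)) / ((n + 1 : ℕ) : EReal)) atTop := by
      funext z
      exact (liminf_nat_add
        (fun n : ℕ => ENNReal.log ((P n z : Measure X) (B i)) / (n : EReal)) 1).symm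
    rw [this]
    refine Measurable.liminf fun n => ?_
    have := ENNReal.measurable_log.comp
      ((hFeller (n + 1) (by omega)).measurable_closed (F := B i) Metric.isClosed_closedBall)
    simp_rw [EReal.div_eq_inv_mul]
    exact measurable_const.mul this
  refine ⟨fun i z => (-L i z).toENNReal, fun i => (hL i).neg.ereal_toENNReal, fun i z => ?_⟩
  obtain ⟨hlow, hup⟩ := (hLDP z).2 (B i) Metric.isClosed_closedBall.measurableSet
  rw [Metric.isClosed_closedBall.closure_eq] at hup
  have hle := (liminf_le_limsup (by isBoundedDefault) (by isBoundedDefault)).trans hup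
  rw [EReal.le_neg] at hle
  rw [EReal.neg_le] at hlow
  constructor
  · intro a ha
    rw [← EReal.coe_ennreal_le_coe_ennreal_iff, EReal.coe_toENNReal]
    · refine le_trans (le_iInf₂ fun x hx => ?_) hle
      exact_mod_cast ha x hx
    · refine le_trans (le_iInf₂ fun x hx => ?_) hle
      exact EReal.coe_ennreal_nonneg _
  · intro x hx
    have hxB : x ∈ interior (B i) := Metric.ball_subset_interior_closedBall hx
    have h := hlow.trans (iInf₂_le x hxB)
    exact (EReal.toENNReal_le_toENNReal h).trans_eq (EReal.toENNReal_coe)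

/-- A continuous function `≤ 1` vanishing off the `i`-th ball, increasing to its indicator. -/
noncomputable def ballCutoff (i : ℕ × ℕ) (j : ℕ) (x : X) : ℝ≥0 :=
  min 1 (j * (ballRadius i - dist x (ballCenter X i)).toNNReal)

theorem continuous_ballCutoff (i : ℕ × ℕ) (j : ℕ) : Continuous (ballCutoff (X := X) i j) := by
  unfold ballCutoff
  fun_prop

theorem ballCutoff_le_one (i : ℕ × ℕ) (j : ℕ) (x : X) : ballCutoff i j x ≤ 1 := min_le_left _ _

theorem ballCutoff_eq_zero {i : ℕ × ℕ} {x : X}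
    (hx : x ∉ Metric.ball (ballCenter X i) (ballRadius i)) (j : ℕ) : ballCutoff i j x = 0 := by
  rw [Metric.mem_ball, not_lt] at hx
  rw [ballCutoff, Real.toNNReal_of_nonpos (by linarith), mul_zero]
  simp

theorem exists_ballCutoff_eq_one {i : ℕ × ℕ} {x : X}
    (hx : x ∈ Metric.ball (ballCenter X i) (ballRadius i)) : ∃ j, ballCutoff i j x = 1 := by
  rw [Metric.mem_ball] at hx
  have hpos : 0 < (ballRadius i - dist x (ballCenter X i)).toNNReal :=
    Real.toNNReal_pos.2 (by linarith)
  obtain ⟨j, hj⟩ := exists_nat_gt (ballRadius i - dist x (ballCenter X i)).toNNReal⁻¹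
  refine ⟨j, min_eq_left ?_⟩
  calc (1 : ℝ≥0) = (ballRadius i - dist x (ballCenter X i)).toNNReal⁻¹ *
        (ballRadius i - dist x (ballCenter X i)).toNNReal := (inv_mul_cancel₀ hpos.ne').symm
    _ ≤ _ := by gcongr

namespace IsBallInfimum

variable {Z : Type*} {c : Z → X → ℝ≥0∞} {ℓ : ℕ × ℕ → Z → ℝ≥0∞}

/-- If `b < c z x`, lower semicontinuity keeps `c z` above `b` on a small closed ball around `x`, so
its `ℓ` is at least `b`, and some cutoff equals `1` at `x`. Conversely a cutoff vanishes off its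
open ball, where `0 * ∞ = 0` makes the term harmless. -/
theorem eq_iSup (h : IsBallInfimum c ℓ) (hc : ∀ z, LowerSemicontinuous (c z)) (z : Z) (x : X) :
    c z x = ⨆ p : (ℕ × ℕ) × ℕ, (ballCutoff p.1 p.2 x : ℝ≥0∞) * ℓ p.1 z := by
  refine le_antisymm (le_of_forall_lt fun a ha => ?_) (iSup_le fun p => ?_)
  · obtain ⟨b, hab, hb⟩ := exists_between ha
    obtain ⟨i, hxi, hi⟩ := exists_closedBall_subset ((hc z).isOpen_preimage b) hb
    obtain ⟨j, hj⟩ := exists_ballCutoff_eq_one hxi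
    refine hab.trans_le (le_iSup_of_le (i, j) ?_)
    rw [hj, ENNReal.coe_one, one_mul]
    exact (h i z).1 b fun y hy => le_of_lt (hi hy)
  · by_cases hx : x ∈ Metric.ball (ballCenter X p.1) (ballRadius p.1)
    · refine le_trans ?_ ((h p.1 z).2 x hx)
      exact mul_le_of_le_one_left' (by exact_mod_cast ballCutoff_le_one p.1 p.2 x)
    · simp [ballCutoff_eq_zero hx]

/-- This exchanges an uncountable infimum for a countable one, which is measurable in `z`. Little is
lost because `f` is nearly constant on small balls around a near-minimizer. -/
theorem infTransform_eq {c : X → X → ℝ≥0∞} {ℓ : ℕ × ℕ → X → ℝ≥0∞} (h : IsBallInfimum c ℓ)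
    (f : X →ᵇ ℝ) (z : X) :
    infTransform c f z = ⨅ i, ((ℓ i z : EReal) +
      ⨆ x ∈ Metric.closedBall (ballCenter X i) (ballRadius i), ((f x : ℝ) : EReal)) := by
  refine le_antisymm (le_iInf fun i => ?_) (le_iInf fun x => ?_)
  · set s : EReal := ⨆ x ∈ Metric.closedBall (ballCenter X i) (ballRadius i), ((f x : ℝ) : EReal)
      with hs
    have hsle : ∀ x ∈ Metric.closedBall (ballCenter X i) (ballRadius i),
        ((f x : ℝ) : EReal) ≤ s := fun x hx =>
      le_iSup₂ (f := fun x (_ : x ∈ Metric.closedBall (ballCenter X i) (ballRadius i)) =>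
        ((f x : ℝ) : EReal)) x hx
    have hbot : s ≠ ⊥ := by
      have hr : 0 ≤ ballRadius i := Nat.one_div_pos_of_nat.le
      exact ne_bot_of_le_ne_bot (EReal.coe_ne_bot _) (hsle _ (Metric.mem_closedBall_self hr))
    have htop : s ≠ ⊤ := by
      refine ne_top_of_le_ne_top (EReal.coe_ne_top ‖f‖) (iSup₂_le fun x _ => ?_)
      exact EReal.coe_le_coe_iff.2 ((le_abs_self _).trans (f.norm_coe_le_norm x))
    rw [← EReal.sub_le_iff_le_add (Or.inl hbot) (Or.inl htop)]
    -- The defining property of `ℓ` tests only bounds in `[0,∞]`, so the difference is replaced by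
    -- its positive part.
    refine ((le_max_right _ _).trans_eq EReal.coe_toENNReal_eq_max.symm).trans
      (EReal.coe_ennreal_le_coe_ennreal_iff.2
      ((h i z).1 _ fun x hx => ?_))
    rw [← EReal.coe_ennreal_le_coe_ennreal_iff, EReal.coe_toENNReal_eq_max]
    refine max_le (EReal.coe_ennreal_nonneg _)
      ((EReal.sub_le_iff_le_add (Or.inl hbot) (Or.inl htop)).2 ?_)
    exact (iInf_le _ x).trans (add_le_add_right (hsle x hx) _)
  · refine le_of_forall_gt fun b hb => ?_
    obtain ⟨q, hq, hqb⟩ := EReal.lt_iff_exists_real_btwn.1 hb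
    have hctop : (c z x : EReal) ≠ ⊤ := by
      intro htop
      rw [htop, EReal.top_add_coe] at hq
      exact not_top_lt hq
    obtain ⟨r, hr⟩ : ∃ r : ℝ, (c z x : EReal) = r :=
      ⟨_, (EReal.coe_toReal hctop (EReal.coe_ennreal_ne_bot _)).symm⟩
    rw [hr, ← EReal.coe_add, EReal.coe_lt_coe_iff] at hq
    obtain ⟨i, hxi, hi⟩ := exists_closedBall_subset
      (isOpen_Iio.preimage f.continuous : IsOpen (f ⁻¹' Iio (q - r))) (x := x)
      (show f x < q - r by linarith)
    refine (iInf_le _ i).trans_lt (lt_of_le_of_lt ?_ hqb)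
    calc _ ≤ (r : EReal) + ((q - r : ℝ) : EReal) := by
          refine add_le_add ?_ (iSup₂_le fun y hy => EReal.coe_le_coe_iff.2 (le_of_lt (hi hy)))
          rw [← hr]
          exact EReal.coe_ennreal_le_coe_ennreal_iff.2 ((h i z).2 x hxi)
      _ = q := by rw [← EReal.coe_add]; congr 1; ring

theorem measurable_infTransform [MeasurableSpace X] {c : X → X → ℝ≥0∞}
    {ℓ : ℕ × ℕ → X → ℝ≥0∞} (h : IsBallInfimum c ℓ) (hℓ : ∀ i, Measurable (ℓ i)) (f : X →ᵇ ℝ) :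
    Measurable (infTransform c f) := by
  rw [show infTransform c f = _ from funext (h.infTransform_eq f)]
  exact Measurable.iInf fun i => (hℓ i).coe_ereal_ennreal.add measurable_const

theorem measurable_uncurry [MeasurableSpace X] [OpensMeasurableSpace X] [MeasurableSpace Z]
    (h : IsBallInfimum c ℓ) (hc : ∀ z, LowerSemicontinuous (c z)) (hℓ : ∀ i, Measurable (ℓ i)) :
    Measurable (Function.uncurry c) := by
  rw [show Function.uncurry c = _ from funext fun p => h.eq_iSup hc p.1 p.2]
  exact Measurable.iSup fun i =>
    ((continuous_ballCutoff i.1 i.2).measurable.comp measurable_snd).coe_nnreal_ennreal.mul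
      ((hℓ i.1).comp measurable_fst)

end IsBallInfimum

end Balls

/-! ### Bounds on the transform and the duality formula -/

/-- The full space has probability one, so the rate function of a large deviation principle has
infimum zero. -/
theorem ObeysLDP.exists_rate_lt {V : Type*} [TopologicalSpace V] [MeasurableSpace V]
    {ρ : ℕ → ProbabilityMeasure V} {I : V → ℝ≥0∞} (h : ObeysLDP ρ I) {ε : ℝ≥0∞} (hε : 0 < ε) :
    ∃ v, I v < ε := by
  by_contra! hI
  have hup := (h.2 univ MeasurableSet.univ).2
  simp only [measure_univ, ENNReal.log_one, EReal.zero_div, limsup_const, closure_univ] at hup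
  rw [EReal.le_neg, neg_zero] at hup
  have : (ε : EReal) ≤ 0 := le_trans (le_iInf₂ fun v _ => by exact_mod_cast hI v) hup
  exact absurd hε (not_lt.2 (by exact_mod_cast this))

section infTransform

variable {X : Type*} [TopologicalSpace X] {c : X → X → ℝ≥0∞}

theorem neg_norm_le_infTransform (f : X →ᵇ ℝ) (z : X) :
    ((-‖f‖ : ℝ) : EReal) ≤ infTransform c f z := by
  refine le_iInf fun x => ?_
  rw [← zero_add ((-‖f‖ : ℝ) : EReal)]
  exact add_le_add (EReal.coe_ennreal_nonneg _)
    (EReal.coe_le_coe_iff.2 (abs_le.1 (f.norm_coe_le_norm x)).1)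

theorem infTransform_le_norm_add_one {z : X} (hz : ∃ x, c z x < 1) (f : X →ᵇ ℝ) :
    infTransform c f z ≤ ((1 + ‖f‖ : ℝ) : EReal) := by
  obtain ⟨x, hx⟩ := hz
  refine (iInf_le _ x).trans ?_
  rw [EReal.coe_add]
  exact add_le_add ((EReal.coe_ennreal_le_coe_ennreal_iff.2 hx.le).trans_eq (by simp))
    (EReal.coe_le_coe_iff.2 (abs_le.1 (f.norm_coe_le_norm x)).2)

theorem infTransform_ne_bot (f : X →ᵇ ℝ) (z : X) : infTransform c f z ≠ ⊥ :=
  ne_bot_of_le_ne_bot (EReal.coe_ne_bot _) (neg_norm_le_infTransform f z)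

theorem infTransform_ne_top {z : X} (hz : ∃ x, c z x < 1) (f : X →ᵇ ℝ) :
    infTransform c f z ≠ ⊤ :=
  ne_top_of_le_ne_top (EReal.coe_ne_top _) (infTransform_le_norm_add_one hz f)

theorem coe_toReal_infTransform {z : X} (hz : ∃ x, c z x < 1) (f : X →ᵇ ℝ) :
    ((infTransform c f z).toReal : EReal) = infTransform c f z :=
  EReal.coe_toReal (infTransform_ne_top hz f) (infTransform_ne_bot f z)

theorem abs_toReal_infTransform_le {z : X} (hz : ∃ x, c z x < 1) (f : X →ᵇ ℝ) :
    |(infTransform c f z).toReal| ≤ 1 + ‖f‖ := by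
  have h1 := neg_norm_le_infTransform (c := c) f z
  have h2 := infTransform_le_norm_add_one hz f
  rw [← coe_toReal_infTransform hz f, EReal.coe_le_coe_iff] at h1 h2
  exact abs_le.2 ⟨by linarith, h2⟩

end infTransform

section Polish

variable {X : Type*} [TopologicalSpace X] [MeasurableSpace X] [BorelSpace X]

/-- Kantorovich duality, easy direction. -/
theorem integral_infTransform_sub_le_lintegral {c : X → X → ℝ≥0∞}
    (hc : Measurable (Function.uncurry c)) (hz : ∀ z, ∃ x, c z x < 1) (f : X →ᵇ ℝ)
    (hf : Measurable (infTransform c f)) {μ ν ρ : Measure _} [IsProbabilityMeasure ρ]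
    (hρ1 : ρ.map Prod.fst = μ) (hρ2 : ρ.map Prod.snd = ν) :
    ((∫ z, (infTransform c f z).toReal ∂μ - ∫ x, f x ∂ν : ℝ) : EReal)
      ≤ (∫⁻ q : X × X, c q.1 q.2 ∂ρ : ℝ≥0∞) := by
  by_cases htop : ∫⁻ q : X × X, c q.1 q.2 ∂ρ = ⊤
  · rw [htop]; exact le_top
  have hcm : Measurable fun q : X × X => c q.1 q.2 := hc
  have hfin : ∀ᵐ q ∂ρ, c q.1 q.2 < ⊤ := ae_lt_top hcm htop
  have hS : Measurable fun z => (infTransform c f z).toReal := hf.ereal_toReal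
  have hSi : Integrable (fun q : X × X => (infTransform c f q.1).toReal) ρ :=
    Integrable.of_bound (hS.comp measurable_fst).aestronglyMeasurable (1 + ‖f‖)
      (Eventually.of_forall fun q => abs_toReal_infTransform_le (hz q.1) f)
  have hfi : Integrable (fun q : X × X => f q.2) ρ :=
    Integrable.of_bound (f.continuous.measurable.comp measurable_snd).aestronglyMeasurable ‖f‖
      (Eventually.of_forall fun q => f.norm_coe_le_norm q.2)
  have hci : Integrable (fun q : X × X => (c q.1 q.2).toReal) ρ :=
    integrable_toReal_of_lintegral_ne_top hcm.aemeasurable htop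
  rw [← hρ1, ← hρ2, integral_map measurable_fst.aemeasurable hS.aestronglyMeasurable,
    integral_map measurable_snd.aemeasurable f.continuous.measurable.aestronglyMeasurable,
    ← integral_sub hSi hfi, ← ENNReal.ofReal_toReal htop, ← integral_toReal hcm.aemeasurable hfin,
    EReal.coe_ennreal_ofReal, max_eq_left (integral_nonneg fun q => ENNReal.toReal_nonneg),
    EReal.coe_le_coe_iff]
  refine integral_mono_ae (hSi.sub hfi) hci ?_
  filter_upwards [hfin] with q hq
  have h1 : infTransform c f q.1 ≤ (c q.1 q.2 : EReal) + ((f q.2 : ℝ) : EReal) := iInf_le _ q.2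
  rw [← coe_toReal_infTransform (hz q.1) f, ← ENNReal.ofReal_toReal hq.ne,
    EReal.coe_ennreal_ofReal, max_eq_left ENNReal.toReal_nonneg, ← EReal.coe_add,
    EReal.coe_le_coe_iff] at h1
  exact sub_le_iff_le_add.2 h1

variable [PolishSpace X]

/-- Kantorovich duality for a cost which is a countable supremum of products of a measurable
function of the first and a continuous function of the second variable. -/
theorem transportCost_eq_iSup {c : X → X → ℝ≥0∞} (hcm : Measurable (Function.uncurry c))
    {φ : ℕ → X → ℝ≥0} (hφ : ∀ i, Continuous (φ i)) (hφ1 : ∀ i y, φ i y ≤ 1)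
    {ℓ : ℕ → X → ℝ≥0∞} (hℓ : ∀ i, Measurable (ℓ i))
    (hc : ∀ x y, c x y = ⨆ i, (φ i y : ℝ≥0∞) * ℓ i x) (hz : ∀ z, ∃ x, c z x < 1)
    (hf : ∀ f : X →ᵇ ℝ, Measurable (infTransform c f)) (μ ν : ProbabilityMeasure X) :
    (transportCost c μ ν : EReal) = ⨆ f : X →ᵇ ℝ,
      ((∫ z, (infTransform c f z).toReal ∂(μ : Measure X) - ∫ x, f x ∂(ν : Measure X) : ℝ) :
        EReal) := by
  have hint : ∀ f : X →ᵇ ℝ,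
      Integrable (fun z => (infTransform c f z).toReal) (μ : Measure X) := fun f =>
    Integrable.of_bound (hf f).ereal_toReal.aestronglyMeasurable (1 + ‖f‖)
      (Eventually.of_forall fun z => abs_toReal_infTransform_le (hz z) f)
  set S : EReal := ⨆ f : X →ᵇ ℝ,
    ((∫ z, (infTransform c f z).toReal ∂(μ : Measure X) - ∫ x, f x ∂(ν : Measure X) : ℝ) : EReal)
    with hS
  have hle : ∀ f : X →ᵇ ℝ, ((∫ z, (infTransform c f z).toReal ∂(μ : Measure X)
      - ∫ x, f x ∂(ν : Measure X) : ℝ) : EReal) ≤ S := fun f => le_iSup (fun f : X →ᵇ ℝ =>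
    ((∫ z, (infTransform c f z).toReal ∂(μ : Measure X) - ∫ x, f x ∂(ν : Measure X) : ℝ) :
      EReal)) f
  -- The test function `f = 0` has a nonnegative dual value.
  have hS0 : 0 ≤ S := by
    refine le_trans ?_ (hle 0)
    rw [← EReal.coe_zero, EReal.coe_le_coe_iff]
    simp only [BoundedContinuousFunction.coe_zero, Pi.zero_apply, integral_zero, sub_zero]
    refine integral_nonneg fun z => EReal.toReal_nonneg (le_iInf fun x => ?_)
    simpa using EReal.coe_ennreal_nonneg (c z x)
  refine le_antisymm ?_ (iSup_le fun f => ?_)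
  · by_cases htop : S = ⊤
    · rw [htop]; exact le_top
    have hSr : ((S.toReal : ℝ) : EReal) = S :=
      EReal.coe_toReal htop (ne_bot_of_le_ne_bot EReal.zero_ne_bot hS0)
    obtain ⟨ρ, h1, h2, h3⟩ := exists_coupling_lintegral_le hφ hφ1 hℓ hc μ ν (D := S.toReal)
      fun f g hg hgC hgf => by
        rw [← EReal.coe_le_coe_iff, hSr]
        -- Every admissible `g` lies below the transform of `f`, so its dual value is at most that
        -- of `f`.
        refine le_trans (EReal.coe_le_coe_iff.2 (sub_le_sub_right ?_ _)) (hle f)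
        obtain ⟨C, hC⟩ := hgC
        refine integral_mono (Integrable.of_bound hg.aestronglyMeasurable C
          (Eventually.of_forall hC)) (hint f) fun z => ?_
        rw [← EReal.coe_le_coe_iff, coe_toReal_infTransform (hz z) f]
        exact le_iInf (hgf z)
    calc (transportCost c μ ν : EReal) ≤ (ENNReal.ofReal S.toReal : ℝ≥0∞) :=
          EReal.coe_ennreal_le_coe_ennreal_iff.2
            ((iInf₂_le ρ (show ρ ∈ transportPlans μ ν from ⟨h1, h2⟩)).trans h3)
      _ = S := by
          rw [EReal.coe_ennreal_ofReal, max_eq_left (EReal.toReal_nonneg hS0), hSr]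
  · have hT : ENNReal.ofReal (∫ z, (infTransform c f z).toReal ∂(μ : Measure X)
        - ∫ x, f x ∂(ν : Measure X)) ≤ transportCost c μ ν := by
      refine le_iInf₂ fun ρ hρ => ?_
      have := EReal.toENNReal_le_toENNReal
        (integral_infTransform_sub_le_lintegral hcm hz f (hf f) hρ.1 hρ.2)
      rwa [EReal.real_coe_toENNReal, EReal.toENNReal_coe] at this
    refine le_trans ?_ (EReal.coe_ennreal_le_coe_ennreal_iff.2 hT)
    rw [EReal.coe_ennreal_ofReal]
    exact EReal.coe_le_coe_iff.2 (le_max_left _ _)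

end Polish

/-- Kantorovich duality for a cost `c(z, ·)` which is, for each `z`, the good rate function of a
large deviation principle for a sequence `(P k z)`, `k ≥ 1`, of Feller systems of laws on `ℝ^d`.
The first three assertions say that both sides of the duality formula are well defined. -/
theorem mainTheorem5 (d : ℕ)
    (P : ℕ → EuclideanSpace ℝ (Fin d) → ProbabilityMeasure (EuclideanSpace ℝ (Fin d)))
    (c : EuclideanSpace ℝ (Fin d) → EuclideanSpace ℝ (Fin d) → ℝ≥0∞)
    (hFeller : ∀ k : ℕ, 1 ≤ k → IsFellerSystem (P k))
    (hLDP : ∀ z, ObeysLDP (fun k => P k z) (c z))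
    (hgood : ∀ z, IsGoodRate (c z))
    (μ : ProbabilityMeasure (EuclideanSpace ℝ (Fin d))) :
    Measurable (Function.uncurry c) ∧
    (∀ (f : EuclideanSpace ℝ (Fin d) →ᵇ ℝ) (z : EuclideanSpace ℝ (Fin d)),
      infTransform c f z ≠ ⊥ ∧ infTransform c f z ≠ ⊤) ∧
    (∀ f : EuclideanSpace ℝ (Fin d) →ᵇ ℝ,
      Integrable (fun z => (infTransform c f z).toReal)
        (μ : Measure (EuclideanSpace ℝ (Fin d)))) ∧
    ∀ ν : ProbabilityMeasure (EuclideanSpace ℝ (Fin d)),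
      (transportCost c μ ν : EReal) =
        ⨆ f : EuclideanSpace ℝ (Fin d) →ᵇ ℝ,
          ((∫ z, (infTransform c f z).toReal ∂(μ : Measure (EuclideanSpace ℝ (Fin d)))
            - ∫ x, f x ∂(ν : Measure (EuclideanSpace ℝ (Fin d))) : ℝ) : EReal) := by

  have hlsc : ∀ z, LowerSemicontinuous (c z) := fun z => (hLDP z).1
  -- The threshold `1` is the same for all `z`, so the transform is bounded uniformly in `z`, hence
  -- integrable.
  have hz : ∀ z, ∃ x, c z x < 1 := fun z => (hLDP z).exists_rate_lt one_pos
  obtain ⟨ℓ, hℓ, h⟩ := exists_isBallInfimum hFeller hLDP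
  have hmeas : ∀ f, Measurable (infTransform c f) := h.measurable_infTransform hℓ
  have hcm : Measurable (Function.uncurry c) := h.measurable_uncurry hlsc hℓ
  refine ⟨hcm, fun f z => ⟨infTransform_ne_bot f z, infTransform_ne_top (hz z) f⟩, fun f => ?_,
    fun ν => ?_⟩
  · exact Integrable.of_bound (hmeas f).ereal_toReal.aestronglyMeasurable (1 + ‖f‖)
      (Eventually.of_forall fun z => abs_toReal_infTransform_le (hz z) f)
  · let e : ℕ ≃ (ℕ × ℕ) × ℕ := (Denumerable.eqv ((ℕ × ℕ) × ℕ)).symm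
    exact transportCost_eq_iSup hcm (φ := fun n => ballCutoff (e n).1 (e n).2)
      (ℓ := fun n => ℓ (e n).1) (fun n => continuous_ballCutoff _ _)
      (fun n => ballCutoff_le_one _ _) (fun n => hℓ _)
      (fun x y => (h.eq_iSup hlsc x y).trans (e.iSup_comp (g := fun p : (ℕ × ℕ) × ℕ =>
        (ballCutoff p.1 p.2 y : ℝ≥0∞) * ℓ p.1 x)).symm) hz hmeas μ ν
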